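/- Let $n,d\ge 1$ and $N$ be integers and let $0<\varepsilon<1$ be such that $\log_2(n/\varepsilon)\ge 1$ (this is automatic for $n\ge 2$). Consider $N$ qubits on a line. A depth-$d$ 1D-QAC circuit is a product $C=L_dM_d\cdots L_1M_1L_0$, where each $L_k$ is a layer of arbitrary single-qubit unitaries and each $M_k$ is a layer of generalized CZ gates (the gate on a set $T$ of qubits multiplies a computational basis state by $-1$ if all qubits of $T$ are $1$, and fixes it otherwise) acting on pairwise disjoint nonempty intervals of consecutive qubits. Let $C$ be such a circuit, and let $I$ be an arbitrary set of $n$ of the $N$ qubits, the input qubits; the other qubits are ancillas, prepared in an arbitrary fixed pure state $|a\rangle$ (possibly entangled, and of any number). For $x\in\{0,1\}^I$ let $f_C(x)\in[0,1]$ be the probability that measuring a fixed output qubit $q$ (any of the $N$ qubits) of $C(|x\rangle\otimes|a\rangle)$ in the computational basis gives $1$. For $h:\{0,1\}^I\to\mathbb R$ write $\|h\|_2=\left(2^{-n}\sum_{x}h(x)^2\right)^{1/2}$. Then there exist a set $S\subseteq I$ and a function $f:\{0,1\}^I\to[0,1]$ such that 1. $|I\setminus S|\ge \dfrac{n}{(\log_2(n/\varepsilon))^d}$;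 2. $\|f-f_C\|_2\le 4\sqrt{2d\varepsilon}$; 3. for every $z\in\{0,1\}^S$, the restriction $f|_{S,z}:\{0,1\}^{I\setminus S}\to[0,1]$, $f|_{S,z}(y)=f(z,y)$, depends on at most one index: there are $i\in I\setminus S$ and $g:\{0,1\}\to[0,1]$ with $f|_{S,z}(y)=g(y_i)$ for all $y\in\{0,1\}^{I\setminus S}$. -/

import Mathlib

open scoped Matrix

noncomputable section

/-! Bits are Booleans, with `true` for `1`. The computational basis of the qubits in `Q` is the
set of assignments `Q → Bool`; states are amplitude vectors and operators are matrices over it. -/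

/-- The tensor product `⨂ i, U i` of one-qubit operators, one for each of the `N` qubits. -/
def tensorOperator {N : ℕ} (U : Fin N → Matrix Bool Bool ℂ) :
    Matrix (Fin N → Bool) (Fin N → Bool) ℂ :=
  Matrix.of fun y x => ∏ i, U i (y i) (x i)

/-- A layer of single-qubit unitaries on `N` qubits. -/
abbrev SingleQubitLayer (N : ℕ) : Type := Fin N → Matrix.unitaryGroup Bool ℂ

/-- The operator of a layer of single-qubit unitaries. -/
def SingleQubitLayer.operator {N : ℕ} (L : SingleQubitLayer N) :
    Matrix (Fin N → Bool) (Fin N → Bool) ℂ :=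
  tensorOperator fun i => (L i : Matrix Bool Bool ℂ)

/-- The generalized CZ gate with support `T`: it multiplies a basis state by `-1` if all qubits
in `T` are `1`, and fixes it otherwise. -/
def czGate {N : ℕ} (T : Finset (Fin N)) : Matrix (Fin N → Bool) (Fin N → Bool) ℂ :=
  Matrix.diagonal fun x => if ∀ i ∈ T, x i = true then -1 else 1

/-- CZ gates commute, so that a product over a finite set of them makes sense. -/
theorem czGate_commute {N : ℕ} (T T' : Finset (Fin N)) : Commute (czGate T) (czGate T') := by
  unfold czGate
  rw [commute_iff_eq, Matrix.diagonal_mul_diagonal, Matrix.diagonal_mul_diagonal]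
  simp only [mul_comm]

/-- A layer of CZ gates on `N` qubits placed on a line: gates with pairwise disjoint supports,
each support being a nonempty set of consecutive qubits. A layer may have no gate at all. -/
structure CZLayer (N : ℕ) where
  gates : Finset (Finset (Fin N))
  nonempty : ∀ T ∈ gates, T.Nonempty
  interval : ∀ T ∈ gates, (T : Set (Fin N)).OrdConnected
  disjoint : (gates : Set (Finset (Fin N))).PairwiseDisjoint id

/-- The operator of a layer of CZ gates. -/
def CZLayer.operator {N : ℕ} (M : CZLayer N) : Matrix (Fin N → Bool) (Fin N → Bool) ℂ :=
  M.gates.noncommProd czGate fun T _ T' _ _ => czGate_commute T T'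

/-- `OneDimQAC N d`: the depth-`d` 1D-QAC circuits `L_d M_d ⋯ L_1 M_1 L_0` on `N` qubits placed on
a line. The depth is the number of layers of CZ gates. -/
inductive OneDimQAC (N : ℕ) : ℕ → Type
  | init (L : SingleQubitLayer N) : OneDimQAC N 0
  | layer {d : ℕ} (C : OneDimQAC N d) (M : CZLayer N) (L : SingleQubitLayer N) :
      OneDimQAC N (d + 1)

/-- The operator that a circuit performs. -/
def OneDimQAC.operator {N : ℕ} : {d : ℕ} → OneDimQAC N d →
    Matrix (Fin N → Bool) (Fin N → Bool) ℂ
  | _, .init L => L.operator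
  | _, .layer C M L => L.operator * M.operator * C.operator

/-- The amplitudes of `|x⟩ ⊗ |a⟩`: the input qubits, those in `I`, hold the basis state `x`, and
the other qubits, the ancilla, are in the joint state `a`. -/
def initialState {N : ℕ} {I : Finset (Fin N)} (a : EuclideanSpace ℂ ({j // j ∉ I} → Bool))
    (x : {i // i ∈ I} → Bool) : (Fin N → Bool) → ℂ :=
  fun y => if (∀ i : {i // i ∈ I}, y i = x i) then a (fun j => y j) else 0

/-- `f_C(x)`: the probability that measuring the qubit `q` of `C (|x⟩ ⊗ |a⟩)` in the computational
basis gives `1`. -/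
def OneDimQAC.acceptProb {N d : ℕ} (C : OneDimQAC N d) {I : Finset (Fin N)}
    (a : EuclideanSpace ℂ ({j // j ∉ I} → Bool)) (q : Fin N) (x : {i // i ∈ I} → Bool) : ℝ :=
  ∑ y : Fin N → Bool with y q = true, ‖(C.operator *ᵥ initialState a x) y‖ ^ 2

/-- The 2-norm of a function on the Boolean cube with respect to the uniform distribution. -/
def cubeNorm {ι : Type*} [Fintype ι] [DecidableEq ι] (f : (ι → Bool) → ℝ) : ℝ :=
  Real.sqrt ((∑ x, f x ^ 2) / 2 ^ Fintype.card ι)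

/-- The restriction of `f` under the partial assignment `z` to the variables in `S`: a function of
the variables outside `S`. -/
def restrict {ι : Type*} [DecidableEq ι] (f : (ι → Bool) → ℝ) (S : Finset ι)
    (z : {i // i ∈ S} → Bool) (y : {i // i ∉ S} → Bool) : ℝ :=
  f fun i => if h : i ∈ S then z ⟨i, h⟩ else y ⟨i, h⟩

end

/-! ### Local operators and supports -/

/-! The proof follows light cones in the Heisenberg picture. For the unitary `U` of the circuit so
far, `U * localOp i E * Uᴴ` is supported on an interval `J i`. The proof maintains a set `K` of
inputs whose intervals are pairwise disjoint, beginning with all inputs and singletons. Single-qubit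
layers do not enlarge supports; a CZ layer enlarges `J i` by the gates touching it.

Let `m = ⌊log₂ (n/ε)⌋`. A gate touching more than `m` intervals contains all of them except perhaps
the two outermost, hence at least `m - 1` whole light cones. Resampling those inputs acts only
inside the gate, so on average over inputs it sees all ones with probability at most `2^(-(m-1)) ≤
4ε/n` (`sum_ones_le`). Deleting it therefore costs little in mean squared norm. Every remaining gate
touches at most `m` intervals, so keeping every `m`-th input makes the enlarged intervals disjoint
again (`LightCones.layer`). Each layer divides `K.card` by at most `m`, rounding up.

The squared error of a layer is charged to the inputs dropped there, at most `8ε/n` each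
(`LightCones.exists_layer`). These charges telescope to at most `8ε`, and Cauchy–Schwarz over the
layers gives the norm error `√(8dε)`. Passing to probabilities doubles it, to `4√(2dε)`.

At the end `q` lies in at most one of the disjoint light cones. With the inputs outside `K` fixed,
the acceptance probability of the pruned circuit depends on that one input alone
(`OneDimQAC.acceptProb_congr`). -/

theorem tensorOperator_mul {N : ℕ} (U V : Fin N → Matrix Bool Bool ℂ) :
    tensorOperator U * tensorOperator V = tensorOperator (U * V) := by
  ext y x
  simp only [tensorOperator, Matrix.mul_apply, Matrix.of_apply, Pi.mul_apply,
    ← Finset.prod_mul_distrib]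
  rw [Finset.prod_univ_sum, Fintype.piFinset_univ]

theorem tensorOperator_one {N : ℕ} : tensorOperator (1 : Fin N → Matrix Bool Bool ℂ) = 1 := by
  ext y x
  by_cases h : y = x
  · subst h
    simp [tensorOperator]
  · obtain ⟨i, hi⟩ := Function.ne_iff.1 h
    simp only [tensorOperator, Matrix.of_apply, Matrix.one_apply_ne h]
    exact Finset.prod_eq_zero (Finset.mem_univ i) (by simp [Matrix.one_apply_ne hi])

theorem tensorOperator_conjTranspose {N : ℕ} (U : Fin N → Matrix Bool Bool ℂ) :
    (tensorOperator U)ᴴ = tensorOperator fun i => (U i)ᴴ := by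
  ext y x
  simp [tensorOperator, Matrix.conjTranspose_apply]

/-- The operator acting as `E` on the qubit `j` and as the identity on all others. -/
noncomputable def localOp {N : ℕ} (j : Fin N) (E : Matrix Bool Bool ℂ) :
    Matrix (Fin N → Bool) (Fin N → Bool) ℂ :=
  tensorOperator (Pi.mulSingle j E)

theorem localOp_apply {N : ℕ} (j : Fin N) (E : Matrix Bool Bool ℂ) (y x : Fin N → Bool) :
    localOp j E y x = if ∀ i, i ≠ j → y i = x i then E (y j) (x j) else 0 := by
  simp only [localOp, tensorOperator, Matrix.of_apply]
  split_ifs with h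
  · rw [Finset.prod_eq_single j]
    · simp
    · intro i _ hi
      simp [Pi.mulSingle_eq_of_ne hi, h i hi]
    · simp
  · push Not at h
    obtain ⟨i, hi, hne⟩ := h
    exact Finset.prod_eq_zero (Finset.mem_univ i)
      (by simp [Pi.mulSingle_eq_of_ne hi, Matrix.one_apply_ne hne])

theorem commute_localOp {N : ℕ} {i j : Fin N} (h : i ≠ j) (E F : Matrix Bool Bool ℂ) :
    Commute (localOp i E) (localOp j F) := by
  rw [commute_iff_eq, localOp, localOp, tensorOperator_mul, tensorOperator_mul]
  exact congrArg _ (Pi.mulSingle_commute (f := fun _ => Matrix Bool Bool ℂ) h E F)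

theorem commute_diagonal_localOp {N : ℕ} {f : (Fin N → Bool) → ℂ} {j : Fin N}
    (hf : ∀ y x, (∀ i, i ≠ j → y i = x i) → f y = f x) (E : Matrix Bool Bool ℂ) :
    Commute (Matrix.diagonal f) (localOp j E) := by
  rw [commute_iff_eq]
  ext y x
  rw [Matrix.diagonal_mul, Matrix.mul_diagonal, localOp_apply]
  split_ifs with h
  · rw [hf y x h, mul_comm]
  · simp

/-- The operator `A` acts as the identity outside the set `J` of qubits: it commutes with every
operator on a qubit outside `J`. -/
def SupportedOn {N : ℕ} (J : Finset (Fin N)) (A : Matrix (Fin N → Bool) (Fin N → Bool) ℂ) : Prop :=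
  ∀ j, j ∉ J → ∀ E, Commute A (localOp j E)

theorem SupportedOn.mul {N : ℕ} {J : Finset (Fin N)} {A B : Matrix (Fin N → Bool) (Fin N → Bool) ℂ}
    (hA : SupportedOn J A) (hB : SupportedOn J B) : SupportedOn J (A * B) :=
  fun j hj E => (hA j hj E).mul_left (hB j hj E)

theorem SupportedOn.mono {N : ℕ} {J J' : Finset (Fin N)}
    {A : Matrix (Fin N → Bool) (Fin N → Bool) ℂ} (hA : SupportedOn J A) (h : J ⊆ J') :
    SupportedOn J' A :=
  fun j hj E => hA j (fun h' => hj (h h')) E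

/-- Commuting with the projection onto `1` at qubit `j` makes `A` block diagonal with respect to
that qubit. -/
theorem SupportedOn.apply_eq_zero {N : ℕ} {J : Finset (Fin N)}
    {A : Matrix (Fin N → Bool) (Fin N → Bool) ℂ} (hA : SupportedOn J A) {j : Fin N} (hj : j ∉ J)
    {y x : Fin N → Bool} (h : y j ≠ x j) : A y x = 0 := by
  have hd : localOp j (Matrix.diagonal fun b => if b then 1 else 0) =
      Matrix.diagonal fun y : Fin N → Bool => if y j then (1 : ℂ) else 0 := by
    ext y x
    rw [localOp_apply]
    by_cases hyx : y = x
    · subst hyx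
      simp
    · rw [Matrix.diagonal_apply_ne _ hyx]
      split_ifs with h
      · refine Matrix.diagonal_apply_ne _ fun h' => hyx (funext fun i => ?_)
        by_cases hi : i = j
        · rw [hi, h']
        · exact h i hi
      · rfl
  have := congrFun (congrFun (hA j hj (Matrix.diagonal fun b => if b then 1 else 0)) y) x
  rw [hd, Matrix.diagonal_mul, Matrix.mul_diagonal] at this
  cases hy : y j <;> cases hx : x j <;> simp_all

/-- Commuting with the matrix unit from `y j` to `b` at qubit `j` identifies the two diagonal
entries. -/
theorem SupportedOn.apply_update {N : ℕ} {J : Finset (Fin N)}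
    {A : Matrix (Fin N → Bool) (Fin N → Bool) ℂ} (hA : SupportedOn J A) {j : Fin N} (hj : j ∉ J)
    (y : Fin N → Bool) (b : Bool) :
    A (Function.update y j b) (Function.update y j b) = A y y := by
  have := congrFun (congrFun (hA j hj (Matrix.single b (y j) 1)) (Function.update y j b)) y
  rw [Matrix.mul_apply, Matrix.mul_apply, Finset.sum_eq_single (Function.update y j b),
    Finset.sum_eq_single y] at this
  · simpa +contextual [localOp_apply, Function.update_of_ne] using this
  · intro z _ hz
    rw [localOp_apply]
    split_ifs with h
    · rw [Matrix.single_apply_of_ne, zero_mul]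
      refine fun h' => hz (funext fun i => ?_)
      by_cases hi : i = j
      · rw [hi, h'.2]
      · rw [← h i hi, Function.update_of_ne hi]
    · rw [zero_mul]
  · simp
  · intro z _ hz
    rw [localOp_apply]
    split_ifs with h
    · rw [Matrix.single_apply_of_ne, mul_zero]
      refine fun h' => hz (funext fun i => ?_)
      by_cases hi : i = j
      · rw [hi, Function.update_self, h'.1]
      · rw [h i hi, Function.update_of_ne hi]
    · rw [mul_zero]
  · simp

theorem SupportedOn.apply_ones {N : ℕ} {T : Finset (Fin N)}
    {A : Matrix (Fin N → Bool) (Fin N → Bool) ℂ} (hA : SupportedOn T A) {y : Fin N → Bool}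
    (hy : ∀ i ∈ T, y i = true) : A y y = A (fun _ => true) (fun _ => true) := by
  have key : ∀ s : Finset (Fin N), A (s.piecewise (fun _ => true) y) (s.piecewise (fun _ => true) y)
      = A y y := by
    intro s
    induction s using Finset.induction_on with
    | empty => simp
    | insert j s _ ih =>
      rw [Finset.piecewise_insert]
      by_cases hj : j ∈ T
      · have : Function.update (s.piecewise (fun _ => true) y) j true =
            s.piecewise (fun _ => true) y := by
          rw [Function.update_eq_self_iff]
          by_cases hs : j ∈ s <;> simp [hs, hy j hj]
        rw [this, ih]
      · rw [hA.apply_update hj, ih]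
  simpa using (key Finset.univ).symm

/-! ### Layers -/

theorem SingleQubitLayer.conjTranspose_mul_operator {N : ℕ} (L : SingleQubitLayer N) :
    L.operatorᴴ * L.operator = 1 := by
  rw [SingleQubitLayer.operator, tensorOperator_conjTranspose, tensorOperator_mul,
    ← tensorOperator_one]
  refine congrArg _ (funext fun i => ?_)
  exact Matrix.mem_unitaryGroup_iff'.1 (L i).2

theorem SingleQubitLayer.conj_localOp {N : ℕ} (L : SingleQubitLayer N) (j : Fin N)
    (E : Matrix Bool Bool ℂ) :
    L.operatorᴴ * localOp j E * L.operator =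
      localOp j ((L j : Matrix Bool Bool ℂ)ᴴ * E * (L j : Matrix Bool Bool ℂ)) := by
  rw [SingleQubitLayer.operator, localOp, localOp, tensorOperator_conjTranspose,
    tensorOperator_mul, tensorOperator_mul]
  refine congrArg _ (funext fun i => ?_)
  by_cases hi : i = j
  · subst hi
    simp
  · simp only [Pi.mul_apply, Pi.mulSingle_eq_of_ne hi, mul_one]
    exact Matrix.mem_unitaryGroup_iff'.1 (L i).2

/-- Conjugating a commutation relation by a unitary. -/
theorem commute_conj {n : Type*} [Fintype n] [DecidableEq n] {U A B : Matrix n n ℂ}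
    (hU : Uᴴ * U = 1) (h : Commute A (Uᴴ * B * U)) : Commute (U * A * Uᴴ) B := by
  have hU' : U * Uᴴ = 1 := mul_eq_one_comm.1 hU
  have h1 : U * (A * (Uᴴ * B * U)) * Uᴴ = U * A * Uᴴ * B := by
    simp only [mul_assoc, hU', mul_one]
  have h2 : U * ((Uᴴ * B * U) * A) * Uᴴ = B * (U * A * Uᴴ) := by
    simp only [← mul_assoc, hU', one_mul]
  rw [commute_iff_eq, ← h1, ← h2, h.eq]

theorem SupportedOn.conj_singleQubitLayer {N : ℕ} {J : Finset (Fin N)}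
    {A : Matrix (Fin N → Bool) (Fin N → Bool) ℂ} (hA : SupportedOn J A) (L : SingleQubitLayer N) :
    SupportedOn J (L.operator * A * L.operatorᴴ) := by
  intro j hj E
  refine commute_conj L.conjTranspose_mul_operator ?_
  rw [L.conj_localOp]
  exact hA j hj _

/-- The diagonal of a generalized CZ gate. -/
noncomputable def czSign {N : ℕ} (T : Finset (Fin N)) (x : Fin N → Bool) : ℂ :=
  if ∀ i ∈ T, x i = true then -1 else 1

theorem czSign_mul_self {N : ℕ} (T : Finset (Fin N)) (x : Fin N → Bool) :
    czSign T x * czSign T x = 1 := by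
  unfold czSign
  split_ifs <;> simp

theorem star_czSign {N : ℕ} (T : Finset (Fin N)) (x : Fin N → Bool) :
    star (czSign T x) = czSign T x := by
  unfold czSign
  split_ifs <;> simp

theorem czSign_congr {N : ℕ} {T : Finset (Fin N)} {x y : Fin N → Bool}
    (h : ∀ i ∈ T, x i = y i) : czSign T x = czSign T y := by
  unfold czSign
  exact if_congr (forall₂_congr fun i hi => by rw [h i hi]) rfl rfl

theorem CZLayer.operator_eq_diagonal {N : ℕ} (M : CZLayer N) :
    M.operator = Matrix.diagonal fun x => ∏ T ∈ M.gates, czSign T x := by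
  have key : ∀ (s : Finset (Finset (Fin N)))
      (h : (s : Set (Finset (Fin N))).Pairwise (Function.onFun Commute czGate)),
      s.noncommProd czGate h = Matrix.diagonal fun x => ∏ T ∈ s, czSign T x := by
    intro s
    induction s using Finset.induction_on with
    | empty => simp
    | insert T s hT ih =>
      intro h
      rw [Finset.noncommProd_insert_of_notMem _ _ _ _ hT, ih, czGate,
        Matrix.diagonal_mul_diagonal]
      congr 1
      ext x
      rw [Finset.prod_insert hT]
      rfl
  exact key _ _

theorem CZLayer.conjTranspose_operator {N : ℕ} (M : CZLayer N) : M.operatorᴴ = M.operator := by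
  rw [M.operator_eq_diagonal, Matrix.diagonal_conjTranspose]
  congr 1
  ext x
  simp [star_czSign, Pi.star_apply, star_prod, -Complex.star_def]

theorem CZLayer.conjTranspose_mul_operator {N : ℕ} (M : CZLayer N) :
    M.operatorᴴ * M.operator = 1 := by
  rw [M.conjTranspose_operator, M.operator_eq_diagonal, Matrix.diagonal_mul_diagonal,
    ← Matrix.diagonal_one]
  congr 1
  ext x
  rw [← Finset.prod_mul_distrib]
  exact Finset.prod_eq_one fun T _ => czSign_mul_self T x

/-- The set `J` together with the gates of `M` that touch it. -/
def CZLayer.spread {N : ℕ} (M : CZLayer N) (J : Finset (Fin N)) : Finset (Fin N) :=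
  J ∪ (M.gates.filter fun T => ¬Disjoint T J).biUnion id

theorem CZLayer.mem_spread {N : ℕ} {M : CZLayer N} {J : Finset (Fin N)} {j : Fin N} :
    j ∈ M.spread J ↔ j ∈ J ∨ ∃ T ∈ M.gates, ¬Disjoint T J ∧ j ∈ T := by
  simp [CZLayer.spread, and_assoc]

theorem SupportedOn.conj_czLayer {N : ℕ} {J : Finset (Fin N)}
    {A : Matrix (Fin N → Bool) (Fin N → Bool) ℂ} (hA : SupportedOn J A) (M : CZLayer N) :
    SupportedOn (M.spread J) (M.operator * A * M.operatorᴴ) := by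
  intro j hj E
  rw [CZLayer.mem_spread] at hj
  push Not at hj
  obtain ⟨hjJ, hjT⟩ := hj
  set s : Finset (Finset (Fin N)) := M.gates.filter fun T => j ∉ T with hs
  -- Gates containing `j` miss `J`. Nonzero entries of `A` join states that agree off `J`, so the
  -- signs of these gates on the two sides are equal and cancel.
  have hconj : M.operator * A * M.operatorᴴ =
      Matrix.diagonal (fun x => ∏ T ∈ s, czSign T x) * A *
        Matrix.diagonal (fun x => ∏ T ∈ s, czSign T x) := by
    rw [M.conjTranspose_operator, M.operator_eq_diagonal]
    ext y x
    simp only [Matrix.mul_diagonal, Matrix.diagonal_mul]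
    by_cases h : ∀ i, i ∉ J → y i = x i
    · have h1 : ∏ T ∈ M.gates with ¬j ∉ T, czSign T y = ∏ T ∈ M.gates with ¬j ∉ T, czSign T x := by
        refine Finset.prod_congr rfl fun T hT => czSign_congr fun i hi => h i fun hiJ => ?_
        rw [Finset.mem_filter, not_not] at hT
        exact hjT T hT.1 (Finset.not_disjoint_iff.2 ⟨i, hi, hiJ⟩) hT.2
      have h2 : (∏ T ∈ M.gates with ¬j ∉ T, czSign T x) * ∏ T ∈ M.gates with ¬j ∉ T, czSign T x = 1 := by
        rw [← Finset.prod_mul_distrib]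
        exact Finset.prod_eq_one fun T _ => czSign_mul_self T x
      rw [← Finset.prod_filter_mul_prod_filter_not M.gates (fun T => j ∉ T) fun T => czSign T y,
        ← Finset.prod_filter_mul_prod_filter_not M.gates (fun T => j ∉ T) fun T => czSign T x,
        h1, ← hs]
      linear_combination (∏ T ∈ s, czSign T y) * A y x * (∏ T ∈ s, czSign T x) * h2
    · push Not at h
      obtain ⟨i, hi, hne⟩ := h
      simp [hA.apply_eq_zero hi hne]
  have hcomm : Commute (Matrix.diagonal (fun x => ∏ T ∈ s, czSign T x)) (localOp j E) := by
    refine commute_diagonal_localOp (fun y x h => ?_) E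
    refine Finset.prod_congr rfl fun T hT => czSign_congr fun i hi => h i ?_
    rintro rfl
    exact (Finset.mem_filter.1 hT).2 hi
  rw [hconj]
  exact (hcomm.mul_left (hA j hjJ E)).mul_left hcomm

theorem OneDimQAC.conjTranspose_mul_operator {N d : ℕ} (C : OneDimQAC N d) :
    C.operatorᴴ * C.operator = 1 := by
  induction C with
  | init L => exact L.conjTranspose_mul_operator
  | layer C M L ih =>
    simp only [OneDimQAC.operator, Matrix.conjTranspose_mul]
    calc C.operatorᴴ * (M.operatorᴴ * L.operatorᴴ) * (L.operator * M.operator * C.operator)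
        = C.operatorᴴ * (M.operatorᴴ * (L.operatorᴴ * L.operator) * M.operator) * C.operator := by
          simp only [mul_assoc]
      _ = 1 := by
          rw [L.conjTranspose_mul_operator, mul_one, M.conjTranspose_mul_operator, mul_one, ih]

/-! ### The Frobenius norm -/

/-- The Frobenius norm of a matrix. -/
noncomputable def frob {m k : Type*} [Fintype m] [Fintype k] (W : Matrix m k ℂ) : ℝ :=
  ‖WithLp.toLp 2 fun p : m × k => W p.1 p.2‖

theorem frob_nonneg {m k : Type*} [Fintype m] [Fintype k] (W : Matrix m k ℂ) : 0 ≤ frob W :=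
  norm_nonneg _

theorem frob_sq {m k : Type*} [Fintype m] [Fintype k] (W : Matrix m k ℂ) :
    frob W ^ 2 = ∑ x, ∑ y, ‖W y x‖ ^ 2 := by
  rw [frob, EuclideanSpace.norm_sq_eq, Fintype.sum_prod_type_right]

theorem frob_add_le {m k : Type*} [Fintype m] [Fintype k] (V W : Matrix m k ℂ) :
    frob (V + W) ≤ frob V + frob W :=
  norm_add_le (WithLp.toLp 2 fun p : m × k => V p.1 p.2) (WithLp.toLp 2 fun p : m × k => W p.1 p.2)

/-- Asking only that `Uᴴ * U` fix `v` covers partial isometries, which `OneDimQAC.acceptProb_congr`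
needs. -/
theorem sum_norm_sq_mulVec_of_fixed {m : Type*} [Fintype m] {U : Matrix m m ℂ} {v : m → ℂ}
    (hv : (Uᴴ * U) *ᵥ v = v) : ∑ y, ‖(U *ᵥ v) y‖ ^ 2 = ∑ y, ‖v y‖ ^ 2 := by
  have key : ∀ w : m → ℂ, ((∑ y, ‖w y‖ ^ 2 : ℝ) : ℂ) = star w ⬝ᵥ w := by
    intro w
    simp [dotProduct, Complex.conj_mul']
  apply Complex.ofReal_injective
  rw [key, key, Matrix.star_mulVec, ← Matrix.dotProduct_mulVec, Matrix.mulVec_mulVec, hv]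

theorem sum_norm_sq_mulVec {m : Type*} [Fintype m] [DecidableEq m] {U : Matrix m m ℂ}
    (hU : Uᴴ * U = 1) (v : m → ℂ) : ∑ y, ‖(U *ᵥ v) y‖ ^ 2 = ∑ y, ‖v y‖ ^ 2 :=
  sum_norm_sq_mulVec_of_fixed (by rw [hU, Matrix.one_mulVec])

theorem frob_mul_left {m k : Type*} [Fintype m] [DecidableEq m] [Fintype k] {U : Matrix m m ℂ}
    (hU : Uᴴ * U = 1) (W : Matrix m k ℂ) : frob (U * W) = frob W := by
  rw [← sq_eq_sq₀ (frob_nonneg _) (frob_nonneg _), frob_sq, frob_sq]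
  exact Finset.sum_congr rfl fun x _ => sum_norm_sq_mulVec hU fun y => W y x

/-! ### Initial states -/

/-- The matrix whose columns are the initial states. -/
noncomputable def inputMatrix {N : ℕ} {I : Finset (Fin N)}
    (a : EuclideanSpace ℂ ({j // j ∉ I} → Bool)) :
    Matrix (Fin N → Bool) ({i // i ∈ I} → Bool) ℂ :=
  Matrix.of fun y x => initialState a x y

theorem sum_norm_sq_initialState {N : ℕ} {I : Finset (Fin N)}
    (a : EuclideanSpace ℂ ({j // j ∉ I} → Bool)) (x : {i // i ∈ I} → Bool) :
    ∑ y, ‖initialState a x y‖ ^ 2 = ‖a‖ ^ 2 := by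
  rw [EuclideanSpace.norm_sq_eq,
    ← (Equiv.piEquivPiSubtypeProd (fun i => i ∈ I) fun _ => Bool).symm.sum_comp,
    Fintype.sum_prod_type, Finset.sum_eq_single x]
  · refine Finset.sum_congr rfl fun w _ => ?_
    rw [initialState, if_pos]
    · have : (fun j : {j // j ∉ I} =>
          (Equiv.piEquivPiSubtypeProd (fun i => i ∈ I) fun _ => Bool).symm (x, w) j) = w := by
        funext j
        simp [Equiv.piEquivPiSubtypeProd, j.2]
      rw [this]
    · simp [Equiv.piEquivPiSubtypeProd]
  · intro u _ hu
    refine Finset.sum_eq_zero fun w _ => ?_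
    rw [initialState, if_neg]
    · simp
    · intro h
      exact hu (funext fun i => by simpa [Equiv.piEquivPiSubtypeProd] using h i)
  · simp

/-- The operator `⨂ i ∈ B, |β i⟩⟨x i|`, acting as the identity outside `B`. -/
noncomputable def transfer {N : ℕ} {I : Finset (Fin N)} (B : Finset {i // i ∈ I})
    (β x : {i // i ∈ I} → Bool) : Matrix (Fin N → Bool) (Fin N → Bool) ℂ :=
  tensorOperator fun j => if h : ∃ h : j ∈ I, ⟨j, h⟩ ∈ B then
    Matrix.single (β ⟨j, h.fst⟩) (x ⟨j, h.fst⟩) 1 else 1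

theorem transfer_conjTranspose {N : ℕ} {I : Finset (Fin N)} (B : Finset {i // i ∈ I})
    (β x : {i // i ∈ I} → Bool) : (transfer B β x)ᴴ = transfer B x β := by
  rw [transfer, transfer, tensorOperator_conjTranspose]
  refine congrArg _ (funext fun j => ?_)
  split_ifs <;> simp

theorem transfer_mul {N : ℕ} {I : Finset (Fin N)} (B : Finset {i // i ∈ I})
    (β x γ : {i // i ∈ I} → Bool) : transfer B β x * transfer B x γ = transfer B β γ := by
  rw [transfer, transfer, transfer, tensorOperator_mul]
  refine congrArg _ (funext fun j => ?_)
  simp only [Pi.mul_apply]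
  split_ifs <;> simp

theorem transfer_insert {N : ℕ} {I : Finset (Fin N)} {B : Finset {i // i ∈ I}} {i : {i // i ∈ I}}
    (hi : i ∉ B) (β x : {i // i ∈ I} → Bool) :
    transfer (insert i B) β x = localOp (i : Fin N) (Matrix.single (β i) (x i) 1) * transfer B β x := by
  rw [transfer, transfer, localOp, tensorOperator_mul]
  refine congrArg _ (funext fun j => ?_)
  simp only [Pi.mul_apply]
  by_cases hj : j = i
  · subst hj
    simp [hi]
  · rw [Pi.mulSingle_eq_of_ne hj, one_mul]
    have : (∃ h : j ∈ I, (⟨j, h⟩ : {i // i ∈ I}) ∈ insert i B) ↔ ∃ h : j ∈ I, (⟨j, h⟩ : {i // i ∈ I}) ∈ B := by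
      refine exists_congr fun h => ?_
      rw [Finset.mem_insert, or_iff_right]
      rintro rfl
      exact hj rfl
    simp only [this]

theorem transfer_apply {N : ℕ} {I : Finset (Fin N)} (B : Finset {i // i ∈ I})
    (β x : {i // i ∈ I} → Bool) (z y : Fin N → Bool) :
    transfer B β x z y = if (∀ i ∈ B, z i = β i ∧ y i = x i) ∧
      (∀ j, (¬∃ h : j ∈ I, ⟨j, h⟩ ∈ B) → z j = y j) then 1 else 0 := by
  simp only [transfer, tensorOperator, Matrix.of_apply]
  split_ifs with h
  · refine Finset.prod_eq_one fun j _ => ?_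
    split_ifs with hj
    · obtain ⟨h1, h2⟩ := h.1 _ hj.snd
      simp_all
    · rw [h.2 j hj, Matrix.one_apply_eq]
  · rw [not_and_or] at h
    rcases h with h | h
    · push Not at h
      obtain ⟨i, hi, h⟩ := h
      refine Finset.prod_eq_zero (Finset.mem_univ (i : Fin N)) ?_
      rw [dif_pos ⟨i.2, hi⟩, Matrix.single_apply_of_ne]
      exact fun h' => h h'.1.symm h'.2.symm
    · push Not at h
      obtain ⟨j, hj, h⟩ := h
      refine Finset.prod_eq_zero (Finset.mem_univ j) ?_
      rw [dif_neg (by push Not; exact hj), Matrix.one_apply_ne h]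

theorem transfer_mulVec_initialState {N : ℕ} {I : Finset (Fin N)}
    (a : EuclideanSpace ℂ ({j // j ∉ I} → Bool)) (B : Finset {i // i ∈ I})
    (β x : {i // i ∈ I} → Bool) :
    transfer B β x *ᵥ initialState a x = initialState a (B.piecewise β x) := by
  ext z
  -- The only basis state that can contribute to the entry at `z`.
  set y : Fin N → Bool := fun j => if h : ∃ h : j ∈ I, ⟨j, h⟩ ∈ B then x ⟨j, h.fst⟩ else z j with hy
  have hyB : ∀ i ∈ B, y i = x i := fun i hi => by
    rw [hy]
    exact dif_pos ⟨i.2, hi⟩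
  have hyB' : ∀ j, (¬∃ h : j ∈ I, ⟨j, h⟩ ∈ B) → y j = z j := fun j hj => dif_neg hj
  have hI : ∀ i : {i // i ∈ I}, i ∉ B → y i = z i :=
    fun i hi => hyB' i (by rintro ⟨_, h⟩; exact hi h)
  rw [Matrix.mulVec, dotProduct, Finset.sum_eq_single y]
  · rw [transfer_apply, initialState, initialState]
    have h1 : (fun j : {j // j ∉ I} => y j) = fun j : {j // j ∉ I} => z j :=
      funext fun j => hyB' j (fun h => j.2 h.fst)
    rw [h1]
    by_cases hc : ∀ i : {i // i ∈ I}, z i = B.piecewise β x i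
    · rw [if_pos, if_pos, if_pos hc, one_mul]
      · intro i
        by_cases hi : i ∈ B
        · exact hyB i hi
        · rw [hI i hi, hc i, Finset.piecewise_eq_of_notMem _ _ _ hi]
      · refine ⟨fun i hi => ⟨?_, hyB i hi⟩, fun j hj => (hyB' j hj).symm⟩
        rw [hc i, Finset.piecewise_eq_of_mem _ _ _ hi]
    · rw [if_neg hc]
      push Not at hc
      obtain ⟨i, hi⟩ := hc
      by_cases hB : i ∈ B
      · rw [Finset.piecewise_eq_of_mem _ _ _ hB] at hi
        rw [if_neg fun h => hi (h.1 i hB).1, zero_mul]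
      · rw [Finset.piecewise_eq_of_notMem _ _ _ hB, ← hI i hB] at hi
        rw [if_neg (c := ∀ i : {i // i ∈ I}, y i = x i) fun h => hi (h i), mul_zero]
  · intro w _ hw
    rw [transfer_apply, if_neg, zero_mul]
    refine fun h => hw (funext fun j => ?_)
    by_cases hj : ∃ h : j ∈ I, ⟨j, h⟩ ∈ B
    · rw [hyB ⟨j, hj.fst⟩ hj.snd]
      exact (h.1 ⟨j, hj.fst⟩ hj.snd).2
    · rw [hyB' j hj, h.2 j hj]
  · simp

/-- A resolution of the identity on the qubits of `B`; the values of `β` off `B` are immaterial,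
whence the multiplicity. -/
theorem sum_transfer_self {N : ℕ} {I : Finset (Fin N)} (B : Finset {i // i ∈ I}) :
    ∑ β, transfer B β β = (2 ^ (I.card - B.card) : ℂ) • (1 : Matrix (Fin N → Bool) (Fin N → Bool) ℂ) := by
  ext z y
  simp only [Matrix.sum_apply, Matrix.smul_apply, transfer_apply, smul_eq_mul]
  by_cases h : z = y
  · subst h
    rw [Matrix.one_apply_eq, mul_one, Finset.sum_boole]
    have : (Finset.univ.filter fun β : {i // i ∈ I} → Bool =>
        (∀ i ∈ B, z i = β i ∧ z i = β i) ∧ ∀ j, (¬∃ h : j ∈ I, ⟨j, h⟩ ∈ B) → z j = z j) =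
        Fintype.piFinset fun i : {i // i ∈ I} => if i ∈ B then {z i} else Finset.univ := by
      ext β
      simp only [Finset.mem_filter, Finset.mem_univ, true_and, and_self, implies_true, and_true,
        Fintype.mem_piFinset]
      refine forall_congr' fun i => ?_
      by_cases hi : i ∈ B
      · simp [hi, eq_comm (a := z i)]
      · simp [hi]
    rw [this, Fintype.card_piFinset]
    have : ∀ i : {i // i ∈ I}, (if i ∈ B then {z i} else Finset.univ : Finset Bool).card =
        if i ∈ Bᶜ then 2 else 1 := fun i => by
      by_cases hi : i ∈ B <;> simp [hi]
    rw [Finset.prod_congr rfl fun i _ => this i, Finset.prod_ite_mem, Finset.univ_inter,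
      Finset.prod_const, Finset.card_compl]
    simp
  · rw [Matrix.one_apply_ne h, mul_zero]
    refine Finset.sum_eq_zero fun β _ => if_neg fun h' => h (funext fun j => ?_)
    by_cases hj : ∃ h : j ∈ I, ⟨j, h⟩ ∈ B
    · obtain ⟨h1, h2⟩ := h'.1 _ hj.snd
      exact h1.trans h2.symm
    · exact h'.2 j hj

/-! ### The probability that a gate with many inputs acts -/

theorem SupportedOn.conjTranspose {N : ℕ} {J : Finset (Fin N)}
    {A : Matrix (Fin N → Bool) (Fin N → Bool) ℂ} (hA : SupportedOn J A) : SupportedOn J Aᴴ := by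
  intro j hj E
  have h := congrArg Matrix.conjTranspose (hA j hj Eᴴ).eq
  have hE : (localOp j Eᴴ)ᴴ = localOp j E := by
    ext y x
    simp only [Matrix.conjTranspose_apply, localOp_apply, eq_comm (a := x _), apply_ite star,
      star_star, star_zero]
  rw [Matrix.conjTranspose_mul, Matrix.conjTranspose_mul, hE] at h
  exact h.symm

/-- Row `y` of `A` only sees states agreeing with `y` off `T`, and Cauchy–Schwarz bounds its output.
All rows with ones on `T` have the same squared norm, a diagonal entry of `A * Aᴴ`, and their blocks
are disjoint. -/
theorem SupportedOn.sum_ones_le {N : ℕ} {T : Finset (Fin N)}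
    {A : Matrix (Fin N → Bool) (Fin N → Bool) ℂ} (hA : SupportedOn T A)
    (ψ : (Fin N → Bool) → ℂ) :
    ∑ y : Fin N → Bool with ∀ i ∈ T, y i = true, ‖(A *ᵥ ψ) y‖ ^ 2 ≤
      ((A * Aᴴ) (fun _ => true) (fun _ => true)).re * ∑ x, ‖ψ x‖ ^ 2 := by
  have hrow : ∀ y, ((A * Aᴴ) y y).re = ∑ x, ‖A y x‖ ^ 2 := by
    intro y
    have : (A * Aᴴ) y y = ((∑ x, ‖A y x‖ ^ 2 : ℝ) : ℂ) := by
      simp [Matrix.mul_apply, Complex.mul_conj']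
    rw [this, Complex.ofReal_re]
  have hbound : ∀ y : Fin N → Bool, (∀ i ∈ T, y i = true) → ‖(A *ᵥ ψ) y‖ ^ 2 ≤
      ((A * Aᴴ) (fun _ => true) (fun _ => true)).re *
        ∑ x : Fin N → Bool with ∀ j, j ∉ T → y j = x j, ‖ψ x‖ ^ 2 := by
    intro y hy
    rw [← (hA.mul hA.conjTranspose).apply_ones hy, hrow]
    have h1 : (A *ᵥ ψ) y = ∑ x : Fin N → Bool with ∀ j, j ∉ T → y j = x j, A y x * ψ x := by
      rw [Matrix.mulVec, dotProduct, Finset.sum_filter_of_ne]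
      intro x _ hx j hj
      by_contra hne
      exact hx (by rw [hA.apply_eq_zero hj hne, zero_mul])
    calc ‖(A *ᵥ ψ) y‖ ^ 2
        ≤ (∑ x : Fin N → Bool with ∀ j, j ∉ T → y j = x j, ‖A y x‖ * ‖ψ x‖) ^ 2 := by
          rw [h1]
          gcongr
          refine (norm_sum_le _ _).trans_eq (Finset.sum_congr rfl fun x _ => norm_mul _ _)
      _ ≤ _ := Finset.sum_mul_sq_le_sq_mul_sq _ _ _
      _ ≤ _ := by
          gcongr
          exact Finset.subset_univ _
  have hnn : 0 ≤ ((A * Aᴴ) (fun _ => true) (fun _ => true)).re := by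
    rw [hrow]
    positivity
  refine (Finset.sum_le_sum fun y hy => hbound y (Finset.mem_filter.1 hy).2).trans ?_
  rw [← Finset.mul_sum]
  refine mul_le_mul_of_nonneg_left ?_ hnn
  simp_rw [fun y : Fin N → Bool => Finset.sum_filter (s := Finset.univ)
    (fun x : Fin N → Bool => ∀ j, j ∉ T → y j = x j) fun x => ‖ψ x‖ ^ 2]
  rw [Finset.sum_comm]
  refine Finset.sum_le_sum fun x _ => ?_
  rw [← Finset.sum_filter, Finset.sum_const, nsmul_eq_mul]
  refine mul_le_of_le_one_left (sq_nonneg _) ?_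
  rw [Nat.cast_le_one, Finset.card_le_one]
  intro y hy z hz
  simp only [Finset.mem_filter, Finset.mem_univ, true_and] at hy hz
  funext j
  by_cases hj : j ∈ T
  · rw [hy.1 j hj, hz.1 j hj]
  · rw [hy.2 j hj, hz.2 j hj]

theorem supportedOn_conj_one {N : ℕ} {T : Finset (Fin N)}
    {U : Matrix (Fin N → Bool) (Fin N → Bool) ℂ} (hU : Uᴴ * U = 1) :
    SupportedOn T (U * 1 * Uᴴ) := by
  rw [mul_one, mul_eq_one_comm.1 hU]
  exact fun j _ E => Commute.one_left _

theorem supportedOn_conj_transfer {N : ℕ} {I T : Finset (Fin N)} {B : Finset {i // i ∈ I}}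
    {U : Matrix (Fin N → Bool) (Fin N → Bool) ℂ} (hU : Uᴴ * U = 1)
    (hB : ∀ i ∈ B, ∀ E, SupportedOn T (U * localOp (i : Fin N) E * Uᴴ))
    (β x : {i // i ∈ I} → Bool) : SupportedOn T (U * transfer B β x * Uᴴ) := by
  induction B using Finset.induction_on with
  | empty =>
    have : transfer (∅ : Finset {i // i ∈ I}) β x = 1 := by
      rw [← tensorOperator_one, transfer]
      refine congrArg _ (funext fun j => ?_)
      simp
    rw [this]
    exact supportedOn_conj_one hU
  | insert i B hi ih =>
    have h1 := hB i (Finset.mem_insert_self i B) (Matrix.single (β i) (x i) 1)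
    have h2 := ih fun i hi => hB i (Finset.mem_insert_of_mem hi)
    have : U * transfer (insert i B) β x * Uᴴ =
        (U * localOp (i : Fin N) (Matrix.single (β i) (x i) 1) * Uᴴ) * (U * transfer B β x * Uᴴ) := by
      rw [transfer_insert hi]
      calc _ = U * localOp (i : Fin N) (Matrix.single (β i) (x i) 1) * 1 * transfer B β x * Uᴴ := by
            simp only [mul_assoc, one_mul]
        _ = _ := by
            rw [← hU]
            simp only [mul_assoc]
    rw [this]
    exact h1.mul h2

/-- Exchanging the coordinates in `B` between `x` and `β` is an involution: resampling them keeps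
the uniform distribution. -/
theorem sum_piecewise {κ : Type*} [Fintype κ] [DecidableEq κ] (B : Finset κ)
    (g : (κ → Bool) → ℝ) :
    ∑ x, ∑ β, g (B.piecewise β x) = 2 ^ Fintype.card κ * ∑ x, g x := by
  have hinv : Function.Involutive fun p : (κ → Bool) × (κ → Bool) =>
      (B.piecewise p.2 p.1, B.piecewise p.1 p.2) := by
    rintro ⟨x, β⟩
    simp only [Prod.mk.injEq]
    constructor <;> ext i <;> by_cases hi : i ∈ B <;> simp [hi]
  rw [← Fintype.sum_prod_type' (fun x β => g (B.piecewise β x))]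
  have := Equiv.sum_comp hinv.toPerm fun p : (κ → Bool) × (κ → Bool) => g p.1
  simp only [Function.Involutive.coe_toPerm] at this
  rw [this, Fintype.sum_prod_type]
  simp [Finset.mul_sum]

/-- If the light cones of the inputs in `B` lie in `T`, then on average over all inputs the
probability of seeing only ones on `T` is at most `2 ^ (-|B|)`. -/
theorem sum_ones_le {N : ℕ} {I T : Finset (Fin N)} {B : Finset {i // i ∈ I}}
    {U : Matrix (Fin N → Bool) (Fin N → Bool) ℂ} (hU : Uᴴ * U = 1)
    (hB : ∀ i ∈ B, ∀ E, SupportedOn T (U * localOp (i : Fin N) E * Uᴴ))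
    {a : EuclideanSpace ℂ ({j // j ∉ I} → Bool)} (ha : ‖a‖ = 1) :
    ∑ x, ∑ y : Fin N → Bool with ∀ i ∈ T, y i = true, ‖(U *ᵥ initialState a x) y‖ ^ 2 ≤
      2 ^ (I.card - B.card) := by
  set g : ({i // i ∈ I} → Bool) → ℝ := fun x =>
    ∑ y : Fin N → Bool with ∀ i ∈ T, y i = true, ‖(U *ᵥ initialState a x) y‖ ^ 2
  have hUU : U * Uᴴ = 1 := mul_eq_one_comm.1 hU
  have hone : ∀ x, ∑ y, ‖(U *ᵥ initialState a x) y‖ ^ 2 = 1 := fun x => by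
    rw [sum_norm_sq_mulVec hU, sum_norm_sq_initialState, ha, one_pow]
  -- The conjugated `transfer B β x` is supported on `T` and carries the state of input `x` to that
  -- of `B.piecewise β x`. Its product with its adjoint no longer involves `x`.
  have hterm : ∀ x β, g (B.piecewise β x) ≤
      ((U * transfer B β β * Uᴴ) (fun _ => true) (fun _ => true)).re := by
    intro x β
    have h := (supportedOn_conj_transfer hU hB β x).sum_ones_le (U *ᵥ initialState a x)
    have h1 : (U * transfer B β x * Uᴴ) *ᵥ (U *ᵥ initialState a x) =
        U *ᵥ initialState a (B.piecewise β x) := by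
      rw [Matrix.mulVec_mulVec, mul_assoc, hU, mul_one, ← Matrix.mulVec_mulVec,
        transfer_mulVec_initialState]
    have h2 : (U * transfer B β x * Uᴴ) * (U * transfer B β x * Uᴴ)ᴴ = U * transfer B β β * Uᴴ := by
      rw [Matrix.conjTranspose_mul, Matrix.conjTranspose_mul, Matrix.conjTranspose_conjTranspose,
        transfer_conjTranspose]
      calc _ = U * (transfer B β x * (Uᴴ * U) * transfer B x β) * Uᴴ := by simp only [mul_assoc]
        _ = _ := by rw [hU, mul_one, transfer_mul]
    rw [h1, h2, hone, mul_one] at h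
    exact h
  have hsum : ∀ x, ∑ β, g (B.piecewise β x) ≤ 2 ^ (I.card - B.card) := by
    intro x
    refine (Finset.sum_le_sum fun β _ => hterm x β).trans_eq ?_
    rw [← Complex.re_sum, ← Matrix.sum_apply, ← Finset.sum_mul, ← Finset.mul_sum,
      sum_transfer_self, Matrix.mul_smul, mul_one, Matrix.smul_mul, hUU, Matrix.smul_apply,
      Matrix.one_apply_eq, smul_eq_mul, mul_one]
    norm_cast
  have h := (sum_piecewise B g).symm.le.trans (Finset.sum_le_sum fun x _ => hsum x)
  rw [Finset.sum_const, Finset.card_univ, nsmul_eq_mul, Fintype.card_fun, Fintype.card_bool] at h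
  push_cast at h
  exact le_of_mul_le_mul_left h (by positivity)

/-! ### Light cones -/

/-- Every `m`-th element of a finite set. -/
theorem exists_sparse_subset {κ : Type*} [LinearOrder κ] (K : Finset κ) {m : ℕ} (hm : 0 < m) :
    ∃ K' ⊆ K, K.card ≤ m * K'.card ∧ m * K'.card < K.card + m ∧
      ∀ i ∈ K', ∀ j ∈ K', i < j → m < (K.filter fun k => i ≤ k ∧ k ≤ j).card := by
  -- The ceiling of `K.card / m`.
  set c' := (K.card + m - 1) / m with hc'
  have h1 : m * c' ≤ K.card + m - 1 := Nat.mul_div_le _ _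
  have h2 : K.card + m - 1 < m * c' + m := Nat.lt_mul_div_succ _ hm
  have hlt : ∀ t : Fin c', m * t < K.card := fun t => by
    have : m * (t + 1) ≤ m * c' := Nat.mul_le_mul_left m t.2
    rw [mul_add] at this
    omega
  set e := K.orderEmbOfFin rfl
  set φ : Fin c' → κ := fun t => e ⟨m * t, hlt t⟩ with hφ
  have hmono : StrictMono φ := fun s t hst =>
    e.strictMono (Fin.mk_lt_mk.2 (Nat.mul_lt_mul_of_pos_left hst hm))
  refine ⟨Finset.univ.image φ, ?_, ?_, ?_, ?_⟩
  · intro k hk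
    obtain ⟨t, -, rfl⟩ := Finset.mem_image.1 hk
    exact K.orderEmbOfFin_mem rfl _
  · rw [Finset.card_image_of_injective _ hmono.injective, Finset.card_univ, Fintype.card_fin]
    omega
  · rw [Finset.card_image_of_injective _ hmono.injective, Finset.card_univ, Fintype.card_fin]
    omega
  · intro i hi j hj hij
    obtain ⟨s, -, rfl⟩ := Finset.mem_image.1 hi
    obtain ⟨t, -, rfl⟩ := Finset.mem_image.1 hj
    have hst : s < t := hmono.lt_iff_lt.1 hij
    have hst' : m * (s + 1) ≤ m * (t : ℕ) := Nat.mul_le_mul_left m hst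
    rw [mul_add] at hst'
    have hsub : (Finset.Icc (⟨m * s, hlt s⟩ : Fin K.card) ⟨m * t, hlt t⟩).map e.toEmbedding ⊆
        K.filter fun k => φ s ≤ k ∧ k ≤ φ t := by
      intro k hk
      obtain ⟨u, hu, rfl⟩ := Finset.mem_map.1 hk
      rw [Finset.mem_Icc] at hu
      exact Finset.mem_filter.2 ⟨K.orderEmbOfFin_mem rfl _, e.monotone hu.1, e.monotone hu.2⟩
    have := Finset.card_le_card hsub
    rw [Finset.card_map, Fin.card_Icc] at this
    simp only at this
    omega

/-- The intervals `J i`, for `i ∈ K`, are pairwise disjoint and contain the light cones of the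
inputs `i` under the evolution `U`. -/
structure LightCones {N : ℕ} {I : Finset (Fin N)} (U : Matrix (Fin N → Bool) (Fin N → Bool) ℂ)
    (K : Finset {i // i ∈ I}) (J : {i // i ∈ I} → Finset (Fin N)) : Prop where
  ordConnected : ∀ i ∈ K, (J i : Set (Fin N)).OrdConnected
  mem : ∀ i ∈ K, (i : Fin N) ∈ J i
  disjoint : ∀ i ∈ K, ∀ j ∈ K, i < j → Disjoint (J i) (J j)
  supportedOn : ∀ i ∈ K, ∀ E, SupportedOn (J i) (U * localOp (i : Fin N) E * Uᴴ)

section LightCones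

variable {N : ℕ} {I : Finset (Fin N)} {U : Matrix (Fin N → Bool) (Fin N → Bool) ℂ}
  {K : Finset {i // i ∈ I}} {J : {i // i ∈ I} → Finset (Fin N)}

/-- Disjoint intervals are ordered as the points they contain. -/
theorem LightCones.lt (h : LightCones U K J) {i k : {i // i ∈ I}} (hi : i ∈ K) (hk : k ∈ K)
    (hik : i < k) {b c : Fin N} (hb : b ∈ J i) (hc : c ∈ J k) : b < c := by
  have hd := Finset.disjoint_left.1 (h.disjoint i hi k hk hik)
  by_contra! hcb
  rcases le_or_gt (k : Fin N) b with hkb | hbk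
  · exact hd ((h.ordConnected i hi).out (h.mem i hi) hb ⟨hik.le, hkb⟩) (h.mem k hk)
  · exact hd hb ((h.ordConnected k hk).out hc (h.mem k hk) ⟨hcb, hbk.le⟩)

theorem LightCones.subset_of_between (h : LightCones U K J) {T : Finset (Fin N)}
    (hT : (T : Set (Fin N)).OrdConnected) {i k j : {i // i ∈ I}} (hi : i ∈ K) (hk : k ∈ K)
    (hj : j ∈ K) (hik : i < k) (hkj : k < j) (hTi : ¬Disjoint T (J i)) (hTj : ¬Disjoint T (J j)) :
    J k ⊆ T := by
  obtain ⟨b, hbT, hb⟩ := Finset.not_disjoint_iff.1 hTi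
  obtain ⟨c, hcT, hc⟩ := Finset.not_disjoint_iff.1 hTj
  exact fun x hx => hT.out hbT hcT ⟨(h.lt hi hk hik hb hx).le, (h.lt hk hj hkj hx hc).le⟩

/-- Only the leftmost and rightmost intervals touched can stick out of `T`. -/
theorem LightCones.card_touching_le (h : LightCones U K J) {T : Finset (Fin N)}
    (hT : (T : Set (Fin N)).OrdConnected) :
    (K.filter fun i => ¬Disjoint T (J i)).card ≤ (K.filter fun i => J i ⊆ T).card + 2 := by
  set R := K.filter fun i => ¬Disjoint T (J i)
  rcases R.eq_empty_or_nonempty with hR | hR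
  · simp [hR]
  have hsub : R ⊆ (K.filter fun i => J i ⊆ T) ∪ {R.min' hR, R.max' hR} := by
    intro k hk
    have hkK := (Finset.mem_filter.1 hk).1
    rw [Finset.mem_union, Finset.mem_insert, Finset.mem_singleton, or_iff_not_imp_right]
    intro hne
    push Not at hne
    have h1 := Finset.mem_filter.1 (R.min'_mem hR)
    have h2 := Finset.mem_filter.1 (R.max'_mem hR)
    exact Finset.mem_filter.2 ⟨hkK, h.subset_of_between hT h1.1 hkK h2.1
      (lt_of_le_of_ne (R.min'_le k hk) hne.1.symm) (lt_of_le_of_ne (R.le_max' k hk) hne.2) h1.2 h2.2⟩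
  exact (Finset.card_le_card hsub).trans ((Finset.card_union_le _ _).trans
    (Nat.add_le_add_left Finset.card_le_two _))

theorem LightCones.card_between_le (h : LightCones U K J) {T : Finset (Fin N)}
    (hT : (T : Set (Fin N)).OrdConnected) {i j : {i // i ∈ I}} (hi : i ∈ K) (hj : j ∈ K)
    (hTi : ¬Disjoint T (J i)) (hTj : ¬Disjoint T (J j)) :
    (K.filter fun k => i ≤ k ∧ k ≤ j).card ≤ (K.filter fun i => ¬Disjoint T (J i)).card := by
  refine Finset.card_le_card fun k hk => ?_
  obtain ⟨hkK, hik, hkj⟩ := Finset.mem_filter.1 hk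
  refine Finset.mem_filter.2 ⟨hkK, ?_⟩
  rcases hik.eq_or_lt with rfl | hik
  · exact hTi
  rcases hkj.eq_or_lt with rfl | hkj
  · exact hTj
  exact Finset.not_disjoint_iff.2
    ⟨k, h.subset_of_between hT hi hkK hj hik hkj hTi hTj (h.mem k hkK), h.mem k hkK⟩

theorem CZLayer.ordConnected_spread (M : CZLayer N) {A : Finset (Fin N)} {c : Fin N} (hc : c ∈ A)
    (hA : (A : Set (Fin N)).OrdConnected) : (M.spread A : Set (Fin N)).OrdConnected := by
  -- Every point of the spread is joined to `c` inside it, through its gate and then through `A`.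
  have key : ∀ x ∈ M.spread A, Set.uIcc x c ⊆ M.spread A := by
    intro x hx z hz
    rw [Finset.mem_coe, CZLayer.mem_spread]
    rcases CZLayer.mem_spread.1 hx with hx | ⟨T, hT, hTA, hx⟩
    · exact Or.inl (hA.uIcc_subset hx hc hz)
    · obtain ⟨w, hwT, hwA⟩ := Finset.not_disjoint_iff.1 hTA
      rcases Set.uIcc_subset_uIcc_union_uIcc (b := w) hz with hz | hz
      · exact Or.inr ⟨T, hT, hTA, (M.interval T hT).uIcc_subset hx hwT hz⟩
      · exact Or.inl (hA.uIcc_subset hwA hc hz)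
  refine ⟨fun x hx y hy z hz => ?_⟩
  rcases le_total z c with hzc | hcz
  · exact key x hx (Set.mem_uIcc.2 (Or.inl ⟨hz.1, hzc⟩))
  · exact key y hy (Set.mem_uIcc.2 (Or.inr ⟨hcz, hz.2⟩))

theorem CZLayer.disjoint_spread (M : CZLayer N) {A B : Finset (Fin N)} (hAB : Disjoint A B)
    (h : ∀ T ∈ M.gates, Disjoint T A ∨ Disjoint T B) : Disjoint (M.spread A) (M.spread B) := by
  rw [Finset.disjoint_left]
  intro x hxA hxB
  rcases CZLayer.mem_spread.1 hxA with hxA | ⟨T, hT, hTA, hxT⟩ <;>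
    rcases CZLayer.mem_spread.1 hxB with hxB | ⟨T', hT', hTB, hxT'⟩
  · exact Finset.disjoint_left.1 hAB hxA hxB
  · exact (h T' hT').elim (fun h => Finset.disjoint_left.1 h hxT' hxA) hTB
  · exact (h T hT).elim hTA fun h => Finset.disjoint_left.1 h hxT hxB
  · have : T = T' := by
      by_contra hne
      exact Finset.disjoint_left.1 (M.disjoint hT hT' hne) hxT hxT'
    subst this
    exact (h T hT).elim hTA hTB

theorem LightCones.layer (h : LightCones U K J) {M : CZLayer N} {m : ℕ}
    (hM : ∀ T ∈ M.gates, (K.filter fun i => ¬Disjoint T (J i)).card ≤ m)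
    {K' : Finset {i // i ∈ I}} (hK' : K' ⊆ K)
    (hsparse : ∀ i ∈ K', ∀ j ∈ K', i < j → m < (K.filter fun k => i ≤ k ∧ k ≤ j).card)
    (L : SingleQubitLayer N) :
    LightCones (L.operator * M.operator * U) K' fun i => M.spread (J i) where
  ordConnected i hi := M.ordConnected_spread (h.mem i (hK' hi)) (h.ordConnected i (hK' hi))
  mem i hi := CZLayer.mem_spread.2 (Or.inl (h.mem i (hK' hi)))
  disjoint i hi j hj hij := by
    refine M.disjoint_spread (h.disjoint i (hK' hi) j (hK' hj) hij) fun T hT => ?_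
    -- A gate touching both intervals would touch all those between, more than `m` in total.
    by_contra! hT'
    exact absurd ((h.card_between_le (M.interval T hT) (hK' hi) (hK' hj) hT'.1 hT'.2).trans
      (hM T hT)) (hsparse i hi j hj hij).not_ge
  supportedOn i hi E := by
    have := ((h.supportedOn i (hK' hi) E).conj_czLayer M).conj_singleQubitLayer L
    simpa only [Matrix.conjTranspose_mul, mul_assoc] using this

/-- The layer of those gates of `M` that satisfy `p`. -/
def CZLayer.filter (M : CZLayer N) (p : Finset (Fin N) → Prop) [DecidablePred p] : CZLayer N where
  gates := M.gates.filter p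
  nonempty T hT := M.nonempty T (Finset.mem_filter.1 hT).1
  interval T hT := M.interval T (Finset.mem_filter.1 hT).1
  disjoint := M.disjoint.subset (Finset.coe_subset.2 (Finset.filter_subset p M.gates))

/-- The two diagonals differ only where some deleted gate sees all ones, and there by at most `2`; a
union bound over deleted gates follows. -/
theorem CZLayer.frob_sub_filter_sq_le {k : Type*} [Fintype k] (M : CZLayer N)
    (p : Finset (Fin N) → Prop) [DecidablePred p] (W : Matrix (Fin N → Bool) k ℂ) :
    frob ((M.operator - (M.filter p).operator) * W) ^ 2 ≤
      ∑ T ∈ M.gates with ¬p T, 4 * ∑ x, ∑ y : Fin N → Bool with ∀ i ∈ T, y i = true, ‖W y x‖ ^ 2 := by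
  have hnorm : ∀ (s : Finset (Finset (Fin N))) y, ‖∏ T ∈ s, czSign T y‖ = 1 := by
    intro s y
    rw [norm_prod]
    refine Finset.prod_eq_one fun T _ => ?_
    unfold czSign
    split_ifs <;> simp
  have hent : ∀ y x, ‖((M.operator - (M.filter p).operator) * W) y x‖ ^ 2 ≤
      ∑ T ∈ M.gates with ¬p T, 4 * if ∀ i ∈ T, y i = true then ‖W y x‖ ^ 2 else 0 := by
    intro y x
    rw [M.operator_eq_diagonal, (M.filter p).operator_eq_diagonal, Matrix.diagonal_sub,
      Matrix.diagonal_mul, norm_mul, mul_pow]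
    by_cases hy : ∃ T ∈ M.gates.filter fun T => ¬p T, ∀ i ∈ T, y i = true
    · obtain ⟨T, hT, hTy⟩ := hy
      calc _ ≤ 2 ^ 2 * ‖W y x‖ ^ 2 := by
            gcongr
            refine (norm_sub_le _ _).trans_eq ?_
            rw [hnorm, hnorm]
            norm_num
        _ = 4 * if ∀ i ∈ T, y i = true then ‖W y x‖ ^ 2 else 0 := by
            rw [if_pos hTy]
            norm_num
        _ ≤ _ := Finset.single_le_sum
            (f := fun T : Finset (Fin N) => 4 * if ∀ i ∈ T, y i = true then ‖W y x‖ ^ 2 else 0)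
            (fun T _ => by positivity) hT
    · push Not at hy
      have : ∏ T ∈ M.gates, czSign T y = ∏ T ∈ (M.filter p).gates, czSign T y := by
        rw [← Finset.prod_filter_mul_prod_filter_not M.gates p,
          Finset.prod_eq_one (s := M.gates.filter fun T => ¬p T), mul_one]
        · rfl
        · intro T hT
          obtain ⟨i, hi, hyi⟩ := hy T hT
          exact if_neg fun h => hyi (h i hi)
      rw [this, sub_self, norm_zero, zero_pow two_ne_zero, zero_mul]
      exact Finset.sum_nonneg fun T _ => by positivity
  rw [frob_sq]
  refine (Finset.sum_le_sum fun x _ => Finset.sum_le_sum fun y _ => hent y x).trans_eq ?_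
  simp_rw [Finset.sum_comm (s := (Finset.univ : Finset (Fin N → Bool)))]
  rw [Finset.sum_comm]
  refine Finset.sum_congr rfl fun T _ => ?_
  simp only [Finset.mul_sum, Finset.sum_filter, mul_ite, mul_zero]

/-- The bound is proportional to the number of inputs dropped so that the bounds for successive
layers telescope. -/
theorem LightCones.exists_layer (h : LightCones U K J) (hU : Uᴴ * U = 1)
    {a : EuclideanSpace ℂ ({j // j ∉ I} → Bool)} (ha : ‖a‖ = 1) (hI : 0 < I.card) {m : ℕ}
    (hm : 5 ≤ m) {ε : ℝ} (hε : 0 < ε) (hIm : (I.card : ℝ) ≤ 2 ^ (m + 1) * ε) (M : CZLayer N)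
    (L : SingleQubitLayer N) :
    ∃ (M' : CZLayer N) (K' : Finset {i // i ∈ I}) (J' : {i // i ∈ I} → Finset (Fin N)),
      LightCones (L.operator * M'.operator * U) K' J' ∧ K' ⊆ K ∧ K.card ≤ m * K'.card ∧
      frob ((M.operator - M'.operator) * (U * inputMatrix a)) ^ 2 ≤
        2 ^ I.card * (8 * ε * (K.card - K'.card) / I.card) := by
  obtain ⟨K', hK', hcard, hcard', hsparse⟩ := exists_sparse_subset K (m := m) (by omega)
  set p : Finset (Fin N) → Prop := fun T => (K.filter fun i => ¬Disjoint T (J i)).card ≤ m with hp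
  refine ⟨M.filter p, K', _, h.layer (fun T hT => (Finset.mem_filter (p := p).1 hT).2) hK' hsparse L,
    hK', hcard, ?_⟩
  refine (M.frob_sub_filter_sq_le p _).trans ?_
  set D := M.gates.filter fun T => ¬p T with hD
  have hI' : (0 : ℝ) < I.card := by exact_mod_cast hI
  set B : Finset (Fin N) → Finset {i // i ∈ I} := fun T => K.filter fun i => J i ⊆ T with hB
  have hDB : ∀ T ∈ D, m - 1 ≤ (B T).card := by
    intro T hT
    obtain ⟨hTM, hTp⟩ := Finset.mem_filter.1 hT
    have := h.card_touching_le (M.interval T hTM)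
    rw [hp] at hTp
    simp only [hB]
    omega
  have hterm : ∀ T ∈ D, 4 * ∑ x, ∑ y : Fin N → Bool with ∀ i ∈ T, y i = true,
      ‖(U * inputMatrix a) y x‖ ^ 2 ≤ 2 ^ I.card * (16 * ε / I.card) := by
    intro T hT
    have h1 := sum_ones_le (B := B T) (T := T) hU
      (fun i hi E => (h.supportedOn i (Finset.mem_filter.1 hi).1 E).mono (Finset.mem_filter.1 hi).2) ha
    have h2 : I.card - (B T).card + (m + 1) ≤ I.card + 2 := by
      have : (B T).card ≤ I.card := (Finset.card_le_univ _).trans_eq (by simp)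
      have := hDB T hT
      omega
    have h3 : (2 : ℝ) ^ (I.card - (B T).card) * 2 ^ (m + 1) ≤ 2 ^ I.card * 4 := by
      rw [← pow_add, show (4 : ℝ) = 2 ^ 2 by norm_num, ← pow_add]
      exact pow_le_pow_right₀ one_le_two h2
    refine (mul_le_mul_of_nonneg_left h1 (by norm_num)).trans ?_
    rw [← mul_div_assoc, le_div_iff₀ hI']
    calc 4 * (2 : ℝ) ^ (I.card - (B T).card) * I.card
        ≤ 4 * (2 : ℝ) ^ (I.card - (B T).card) * (2 ^ (m + 1) * ε) := by gcongr
      _ = 4 * ε * (2 ^ (I.card - (B T).card) * 2 ^ (m + 1)) := by ring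
      _ ≤ 4 * ε * (2 ^ I.card * 4) := by gcongr
      _ = _ := by ring
  refine (Finset.sum_le_sum hterm).trans ?_
  rw [Finset.sum_const, nsmul_eq_mul]
  -- Deleted gates are disjoint, so each light cone lies in at most one of them.
  have hDK : D.card * (m - 1) ≤ K.card := by
    have hdisj : (D : Set (Finset (Fin N))).PairwiseDisjoint B := by
      intro T hT T' hT' hne
      refine Finset.disjoint_left.2 fun i hi hi' => ?_
      have hd := M.disjoint (Finset.mem_filter.1 hT).1 (Finset.mem_filter.1 hT').1 hne
      obtain ⟨hiK, hiT⟩ := Finset.mem_filter.1 hi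
      exact Finset.disjoint_left.1 hd (hiT (h.mem i hiK))
        ((Finset.mem_filter.1 hi').2 (h.mem i hiK))
    calc D.card * (m - 1) = ∑ T ∈ D, (m - 1) := by rw [Finset.sum_const, smul_eq_mul]
      _ ≤ ∑ T ∈ D, (B T).card := Finset.sum_le_sum hDB
      _ = (D.biUnion B).card := (Finset.card_biUnion hdisj).symm
      _ ≤ K.card := Finset.card_le_card (Finset.biUnion_subset.2 fun T _ => Finset.filter_subset _ _)
  -- If a gate is deleted then `m < K.card`, so `m * K'.card < 2 * K.card`. As `m ≥ 5`, both `2 *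
  -- D.card` and `K'.card` are at most half of `K.card`.
  have hmain : 2 * D.card + K'.card ≤ K.card := by
    rcases D.eq_empty_or_nonempty with hD0 | ⟨T, hT⟩
    · rw [hD0]
      simpa using Finset.card_le_card hK'
    · have hmK : m < K.card :=
        (not_le.1 (Finset.mem_filter.1 hT).2).trans_le (Finset.card_le_card (Finset.filter_subset _ _))
      have h4 : 4 * D.card ≤ K.card := by
        refine le_trans ?_ hDK
        rw [mul_comm]
        exact Nat.mul_le_mul_left _ (by omega)
      have h2 : 2 * K'.card ≤ K.card := by
        obtain ⟨r, rfl⟩ := Nat.exists_eq_add_of_le hm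
        nlinarith
      omega
  have hmain' : 2 * (D.card : ℝ) + K'.card ≤ K.card := by exact_mod_cast hmain
  calc (D.card : ℝ) * (2 ^ I.card * (16 * ε / I.card))
      = 2 ^ I.card * (8 * ε * (2 * D.card) / I.card) := by ring
    _ ≤ _ := by
      gcongr
      linarith

end LightCones

/-- Removing the gates that have too many inputs in their light cones leaves a circuit with many
inputs whose light cones are disjoint. -/
theorem OneDimQAC.exists_lightCones {N : ℕ} {I : Finset (Fin N)}
    {a : EuclideanSpace ℂ ({j // j ∉ I} → Bool)} (ha : ‖a‖ = 1) (hI : 0 < I.card) {m : ℕ}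
    (hm : 5 ≤ m) {ε : ℝ} (hε : 0 < ε) (hIm : (I.card : ℝ) ≤ 2 ^ (m + 1) * ε) {d : ℕ}
    (C : OneDimQAC N d) :
    ∃ (C' : OneDimQAC N d) (K : Finset {i // i ∈ I}) (J : {i // i ∈ I} → Finset (Fin N)),
      LightCones C'.operator K J ∧ I.card ≤ m ^ d * K.card ∧
      frob (C.operator * inputMatrix a - C'.operator * inputMatrix a) ≤
        √(2 ^ I.card) * (√d * √(8 * ε * (I.card - K.card) / I.card)) := by
  induction C with
  | init L =>
    refine ⟨.init L, Finset.univ, fun i => {(i : Fin N)}, ⟨?_, ?_, ?_, ?_⟩, ?_, ?_⟩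
    · intro i _
      rw [Finset.coe_singleton]
      exact Set.ordConnected_singleton
    · exact fun i _ => Finset.mem_singleton_self _
    · intro i _ j _ hij
      rw [Finset.disjoint_singleton]
      exact fun h => hij.ne (Subtype.ext h)
    · intro i _ E
      refine SupportedOn.conj_singleQubitLayer (fun j hj F => commute_localOp (fun h => hj ?_) E F) L
      rw [Finset.mem_singleton, h]
    · simp
    · simp [frob, ← Pi.zero_def]
  | @layer d C M L ih =>
    obtain ⟨C', K, J, hJ, hK, hfrob⟩ := ih
    obtain ⟨M', K', J', hJ', hKK', hcard, hfrob'⟩ :=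
      hJ.exists_layer C'.conjTranspose_mul_operator ha hI hm hε hIm M L
    refine ⟨.layer C' M' L, K', J', hJ', ?_, ?_⟩
    · rw [pow_succ, mul_assoc]
      exact hK.trans (Nat.mul_le_mul_left _ hcard)
    · have hsplit : (OneDimQAC.layer C M L).operator * inputMatrix a -
          (OneDimQAC.layer C' M' L).operator * inputMatrix a =
          L.operator * (M.operator * (C.operator * inputMatrix a - C'.operator * inputMatrix a) +
            (M.operator - M'.operator) * (C'.operator * inputMatrix a)) := by
        simp only [OneDimQAC.operator, Matrix.mul_assoc, Matrix.mul_sub,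
          Matrix.sub_mul, Matrix.mul_add]
        abel
      have hI' : (0 : ℝ) < I.card := by exact_mod_cast hI
      have hKI : (K.card : ℝ) ≤ I.card := by
        exact_mod_cast (Finset.card_le_univ K).trans_eq (by simp)
      have hKK : (K'.card : ℝ) ≤ K.card := by exact_mod_cast Finset.card_le_card hKK'
      set A := 8 * ε * (I.card - K.card) / I.card with hA
      set B := 8 * ε * (K.card - K'.card) / I.card with hB
      have hA0 : 0 ≤ A := div_nonneg (mul_nonneg (by positivity) (by linarith)) hI'.le
      have hB0 : 0 ≤ B := div_nonneg (mul_nonneg (by positivity) (by linarith)) hI'.le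
      have hAB : 8 * ε * (I.card - K'.card) / I.card = A + B := by
        rw [hA, hB]
        ring
      -- Cauchy–Schwarz for the vectors `(√d, 1)` and `(√A, √B)`.
      have hcs : √d * √A + √B ≤ √((d + 1 : ℕ) : ℝ) * √(A + B) := by
        rw [← Real.sqrt_mul (Nat.cast_nonneg (d + 1))]
        refine Real.le_sqrt_of_sq_le ?_
        have h1 : (√d * √A) ^ 2 = d * A := by
          rw [mul_pow, Real.sq_sqrt (Nat.cast_nonneg d), Real.sq_sqrt hA0]
        have h2 : (√d * √B) ^ 2 = d * B := by
          rw [mul_pow, Real.sq_sqrt (Nat.cast_nonneg d), Real.sq_sqrt hB0]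
        have h3 := Real.sq_sqrt hA0
        have h4 := Real.sq_sqrt hB0
        push_cast
        linarith [sq_nonneg (√d * √B - √A)]
      rw [hsplit, frob_mul_left L.conjTranspose_mul_operator, hAB]
      calc _ ≤ frob (C.operator * inputMatrix a - C'.operator * inputMatrix a) +
            frob ((M.operator - M'.operator) * (C'.operator * inputMatrix a)) := by
            refine (frob_add_le _ _).trans_eq ?_
            rw [frob_mul_left M.conjTranspose_mul_operator]
        _ ≤ √(2 ^ I.card) * (√d * √A) + √(2 ^ I.card) * √B := by
            refine add_le_add hfrob ?_
            rw [← Real.sqrt_mul (by positivity)]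
            exact Real.le_sqrt_of_sq_le hfrob'
        _ ≤ _ := by
            rw [← mul_add]
            gcongr

/-! ### The acceptance probability -/

theorem OneDimQAC.sum_norm_sq {N d : ℕ} (C : OneDimQAC N d) {I : Finset (Fin N)}
    {a : EuclideanSpace ℂ ({j // j ∉ I} → Bool)} (ha : ‖a‖ = 1) (x : {i // i ∈ I} → Bool) :
    ∑ y, ‖(C.operator *ᵥ initialState a x) y‖ ^ 2 = 1 := by
  rw [sum_norm_sq_mulVec C.conjTranspose_mul_operator, sum_norm_sq_initialState, ha, one_pow]

theorem OneDimQAC.acceptProb_mem_Icc {N d : ℕ} (C : OneDimQAC N d) {I : Finset (Fin N)}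
    {a : EuclideanSpace ℂ ({j // j ∉ I} → Bool)} (ha : ‖a‖ = 1) (q : Fin N)
    (x : {i // i ∈ I} → Bool) : C.acceptProb a q x ∈ Set.Icc (0 : ℝ) 1 := by
  refine ⟨Finset.sum_nonneg fun y _ => sq_nonneg _, ?_⟩
  rw [← C.sum_norm_sq ha x]
  exact Finset.sum_le_sum_of_subset_of_nonneg (Finset.filter_subset _ _) fun y _ _ => sq_nonneg _

theorem OneDimQAC.sq_acceptProb_sub_le {N d : ℕ} (C C' : OneDimQAC N d) {I : Finset (Fin N)}
    {a : EuclideanSpace ℂ ({j // j ∉ I} → Bool)} (ha : ‖a‖ = 1) (q : Fin N)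
    (x : {i // i ∈ I} → Bool) :
    (C'.acceptProb a q x - C.acceptProb a q x) ^ 2 ≤
      4 * ∑ y, ‖(C.operator * inputMatrix a - C'.operator * inputMatrix a) y x‖ ^ 2 := by
  set u := C.operator *ᵥ initialState a x
  set v := C'.operator *ᵥ initialState a x
  have hu : ∑ y, ‖u y‖ ^ 2 = 1 := C.sum_norm_sq ha x
  have hv : ∑ y, ‖v y‖ ^ 2 = 1 := C'.sum_norm_sq ha x
  have habs : |C'.acceptProb a q x - C.acceptProb a q x| ≤
      ∑ y, ‖u y - v y‖ * (‖u y‖ + ‖v y‖) := by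
    rw [OneDimQAC.acceptProb, OneDimQAC.acceptProb, ← Finset.sum_sub_distrib]
    refine (Finset.abs_sum_le_sum_abs _ _).trans ((Finset.sum_le_sum fun y _ => ?_).trans
      (Finset.sum_le_sum_of_subset_of_nonneg (Finset.filter_subset _ _) fun y _ _ => by positivity))
    calc |‖v y‖ ^ 2 - ‖u y‖ ^ 2| = |‖u y‖ - ‖v y‖| * (‖u y‖ + ‖v y‖) := by
          rw [← abs_of_nonneg (a := ‖u y‖ + ‖v y‖) (by positivity), ← abs_mul, abs_sub_comm]
          congr 1
          ring_nf
      _ ≤ _ := by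
          gcongr
          exact abs_norm_sub_norm_le _ _
  have hsq : ∑ y, (‖u y‖ + ‖v y‖) ^ 2 ≤ 4 := by
    calc ∑ y, (‖u y‖ + ‖v y‖) ^ 2 ≤ ∑ y, (2 * ‖u y‖ ^ 2 + 2 * ‖v y‖ ^ 2) :=
          Finset.sum_le_sum fun y _ => by linarith [sq_nonneg (‖u y‖ - ‖v y‖)]
      _ = 4 := by
          rw [Finset.sum_add_distrib, ← Finset.mul_sum, ← Finset.mul_sum, hu, hv]
          norm_num
  calc (C'.acceptProb a q x - C.acceptProb a q x) ^ 2
      = |C'.acceptProb a q x - C.acceptProb a q x| ^ 2 := (sq_abs _).symm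
    _ ≤ (∑ y, ‖u y - v y‖ * (‖u y‖ + ‖v y‖)) ^ 2 := by gcongr
    _ ≤ (∑ y, ‖u y - v y‖ ^ 2) * ∑ y, (‖u y‖ + ‖v y‖) ^ 2 := Finset.sum_mul_sq_le_sq_mul_sq _ _ _
    _ ≤ (∑ y, ‖u y - v y‖ ^ 2) * 4 := by gcongr
    _ = _ := mul_comm _ _

theorem OneDimQAC.cubeNorm_acceptProb_sub_le {N d : ℕ} (C C' : OneDimQAC N d) {I : Finset (Fin N)}
    {a : EuclideanSpace ℂ ({j // j ∉ I} → Bool)} (ha : ‖a‖ = 1) (q : Fin N) :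
    cubeNorm (fun x => C'.acceptProb a q x - C.acceptProb a q x) ≤
      2 * frob (C.operator * inputMatrix a - C'.operator * inputMatrix a) / √(2 ^ I.card) := by
  have h := Finset.sum_le_sum fun x (_ : x ∈ Finset.univ) => C.sq_acceptProb_sub_le C' ha q x
  rw [← Finset.mul_sum, ← frob_sq] at h
  rw [cubeNorm, Real.sqrt_div' _ (by positivity), Fintype.card_coe]
  gcongr
  refine Real.sqrt_le_iff.2 ⟨mul_nonneg zero_le_two (frob_nonneg _), h.trans_eq ?_⟩
  ring

theorem OneDimQAC.acceptProb_eq_sum {N d : ℕ} (C : OneDimQAC N d) {I : Finset (Fin N)}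
    (a : EuclideanSpace ℂ ({j // j ∉ I} → Bool)) (q : Fin N) (x : {i // i ∈ I} → Bool) :
    C.acceptProb a q x = ∑ y, ‖((Matrix.diagonal fun y : Fin N → Bool => if y q then (1 : ℂ) else 0) *ᵥ
      (C.operator *ᵥ initialState a x)) y‖ ^ 2 := by
  rw [OneDimQAC.acceptProb, Finset.sum_filter]
  refine Finset.sum_congr rfl fun y _ => ?_
  rw [Matrix.mulVec_diagonal]
  split_ifs <;> simp

/-- The acceptance probability depends only on the inputs whose light cones contain `q`. -/
theorem OneDimQAC.acceptProb_congr {N d : ℕ} {C : OneDimQAC N d} {I : Finset (Fin N)}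
    {K : Finset {i // i ∈ I}} {J : {i // i ∈ I} → Finset (Fin N)} (h : LightCones C.operator K J)
    (a : EuclideanSpace ℂ ({j // j ∉ I} → Bool)) {q : Fin N} {x x' : {i // i ∈ I} → Bool}
    (hx : ∀ i, x i ≠ x' i → i ∈ K ∧ q ∉ J i) : C.acceptProb a q x = C.acceptProb a q x' := by
  set U := C.operator with hU
  have hUU : Uᴴ * U = 1 := C.conjTranspose_mul_operator
  set B : Finset {i // i ∈ I} := Finset.univ.filter fun i => x i ≠ x' i with hB
  set Q : Matrix (Fin N → Bool) (Fin N → Bool) ℂ := Matrix.diagonal fun y => if y q then 1 else 0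
    with hQ
  have hx' : B.piecewise x' x = x' := by
    funext i
    by_cases hi : x i = x' i <;> simp [hB, Finset.piecewise, hi]
  have hBJ : ∀ i ∈ B, ∀ E, SupportedOn (Finset.univ.erase q) (U * localOp (i : Fin N) E * Uᴴ) := by
    intro i hi E
    obtain ⟨hiK, hq⟩ := hx i (Finset.mem_filter.1 hi).2
    exact (h.supportedOn i hiK E).mono
      (Finset.subset_erase.2 ⟨Finset.subset_univ _, hq⟩)
  -- Changing inputs whose light cones avoid `q` acts away from `q`, hence commutes with measuring
  -- it.
  have hcomm : ∀ β γ, Commute (U * transfer B β γ * Uᴴ) Q := by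
    intro β γ
    rw [commute_iff_eq]
    ext z y
    rw [hQ, Matrix.mul_diagonal, Matrix.diagonal_mul]
    by_cases hzy : z q = y q
    · rw [hzy, mul_comm]
    · rw [(supportedOn_conj_transfer hUU hBJ β γ).apply_eq_zero (Finset.notMem_erase q _) hzy]
      simp
  set A := U * transfer B x' x * Uᴴ with hA
  have hAA : Aᴴ * A = U * transfer B x x * Uᴴ := by
    rw [hA, Matrix.conjTranspose_mul, Matrix.conjTranspose_mul, Matrix.conjTranspose_conjTranspose,
      transfer_conjTranspose]
    calc _ = U * (transfer B x x' * (Uᴴ * U) * transfer B x' x) * Uᴴ := by simp only [mul_assoc]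
      _ = _ := by rw [hUU, mul_one, transfer_mul]
  have hact : ∀ β, (U * transfer B β x * Uᴴ) *ᵥ (U *ᵥ initialState a x) =
      U *ᵥ initialState a (B.piecewise β x) := by
    intro β
    rw [Matrix.mulVec_mulVec, mul_assoc, hUU, mul_one, ← Matrix.mulVec_mulVec,
      transfer_mulVec_initialState]
  -- So `A` preserves the norm of the projected state for `x` and, commuting with `Q`, carries it to
  -- the one for `x'`.
  have hfix : (Aᴴ * A) *ᵥ (Q *ᵥ (U *ᵥ initialState a x)) = Q *ᵥ (U *ᵥ initialState a x) := by
    rw [hAA, Matrix.mulVec_mulVec, (hcomm x x).eq, ← Matrix.mulVec_mulVec, hact,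
      Finset.piecewise_same]
  rw [C.acceptProb_eq_sum, C.acceptProb_eq_sum, ← hU, ← hQ,
    ← sum_norm_sq_mulVec_of_fixed hfix, Matrix.mulVec_mulVec, hA, (hcomm x' x).eq,
    ← Matrix.mulVec_mulVec, hact, hx']

theorem OneDimQAC.exists_restrict_acceptProb_eq {N d : ℕ} {C : OneDimQAC N d} {I : Finset (Fin N)}
    {K : Finset {i // i ∈ I}} {J : {i // i ∈ I} → Finset (Fin N)} (h : LightCones C.operator K J)
    (hK : K.Nonempty) {a : EuclideanSpace ℂ ({j // j ∉ I} → Bool)} (ha : ‖a‖ = 1) (q : Fin N)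
    (z : {i // i ∈ Kᶜ} → Bool) :
    ∃ (i : {i // i ∉ Kᶜ}) (g : Bool → ℝ), (∀ b, g b ∈ Set.Icc (0 : ℝ) 1) ∧
      ∀ y : {i // i ∉ Kᶜ} → Bool, restrict (C.acceptProb a q) Kᶜ z y = g (y i) := by
  -- The input whose light cone contains `q`, or any element of `K` if there is none.
  obtain ⟨i, hi, hiq⟩ : ∃ i ∈ K, ∀ j ∈ K, j ≠ i → q ∉ J j := by
    by_cases hq : ∃ i ∈ K, q ∈ J i
    · obtain ⟨i, hi, hqi⟩ := hq
      refine ⟨i, hi, fun j hj hji hqj => ?_⟩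
      rcases hji.lt_or_gt with hlt | hlt
      · exact Finset.disjoint_left.1 (h.disjoint j hj i hi hlt) hqj hqi
      · exact Finset.disjoint_left.1 (h.disjoint i hi j hj hlt) hqi hqj
    · push Not at hq
      obtain ⟨i, hi⟩ := hK
      exact ⟨i, hi, fun j hj _ => hq j hj⟩
  refine ⟨⟨i, by simpa using hi⟩, fun b => restrict (C.acceptProb a q) Kᶜ z fun _ => b,
    fun b => C.acceptProb_mem_Icc ha q _, fun y => C.acceptProb_congr h a fun j hj => ?_⟩
  have hjK : j ∉ Kᶜ := fun hjK => hj (by simp only [dif_pos hjK])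
  refine ⟨by simpa using hjK, hiq j (by simpa using hjK) ?_⟩
  rintro rfl
  exact hj (by simp only [dif_neg hjK])

theorem mainTheorem7 (n d N : ℕ) (hn : 1 ≤ n) (hd : 1 ≤ d) (ε : ℝ) (hε0 : 0 < ε) (hε1 : ε < 1)
    (hlog : 1 ≤ Real.logb 2 (n / ε))
    (C : OneDimQAC N d) (I : Finset (Fin N)) (hI : I.card = n)
    (a : EuclideanSpace ℂ ({j // j ∉ I} → Bool)) (ha : ‖a‖ = 1) (q : Fin N) :
    ∃ (S : Finset {i // i ∈ I}) (f : ({i // i ∈ I} → Bool) → ℝ),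
      (n : ℝ) / Real.logb 2 (n / ε) ^ d ≤ (Sᶜ.card : ℝ) ∧
      (∀ x, f x ∈ Set.Icc (0 : ℝ) 1) ∧
      cubeNorm (fun x => f x - C.acceptProb a q x) ≤ 4 * Real.sqrt (2 * d * ε) ∧
      ∀ z : {i // i ∈ S} → Bool, ∃ (i : {i // i ∉ S}) (g : Bool → ℝ),
        (∀ b, g b ∈ Set.Icc (0 : ℝ) 1) ∧
        ∀ y : {i // i ∉ S} → Bool, restrict f S z y = g (y i) := by
  have hn0 : (0 : ℝ) < n := by exact_mod_cast hn
  have hd1 : (1 : ℝ) ≤ d := by exact_mod_cast hd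
  have h4 : 4 * √(2 * d * ε) = √(32 * d * ε) := by
    rw [show (32 : ℝ) * d * ε = 4 ^ 2 * (2 * d * ε) by ring,
      Real.sqrt_mul (sq_nonneg 4), Real.sqrt_sq (by norm_num)]
  rw [h4]
  -- If the allowed error is at least `1`, the zero function with `S = ∅` suffices. Otherwise `ε <
  -- 1/32`, which yields `m ≥ 5`.
  rcases le_or_gt 1 (32 * d * ε) with hbig | hsmall
  · obtain ⟨i, hi⟩ : I.Nonempty := Finset.card_pos.1 (by omega)
    refine ⟨∅, fun _ => 0, ?_, fun _ => by simp, ?_, fun z => ⟨⟨⟨i, hi⟩, by simp⟩, fun _ => 0,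
      fun _ => by simp, fun y => rfl⟩⟩
    · rw [Finset.compl_empty, Finset.card_univ, Fintype.card_coe, hI]
      exact div_le_self hn0.le (one_le_pow₀ hlog)
    · rw [cubeNorm]
      refine Real.sqrt_le_sqrt (le_trans ?_ hbig)
      rw [div_le_one (by positivity)]
      refine (Finset.sum_le_sum fun x _ => (?_ : _ ≤ (1 : ℝ))).trans_eq ?_
      · obtain ⟨h0, h1⟩ := C.acceptProb_mem_Icc ha q x
        rw [zero_sub, neg_sq]
        exact pow_le_one₀ h0 h1
      · simp
  · have hnε : 0 < n / ε := div_pos hn0 hε0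
    set l := Real.logb 2 (n / ε) with hl
    have hl5 : 5 ≤ l := by
      rw [hl, Real.le_logb_iff_rpow_le one_lt_two hnε, le_div_iff₀ hε0]
      have h1 : (1 : ℝ) ≤ n := by exact_mod_cast hn
      norm_num
      nlinarith
    -- Rounding down gives `m ^ d ≤ l ^ d` for the size bound, while `l < m + 1` gives `n ≤ 2 ^ (m +
    -- 1) * ε` for the error bound.
    set m := ⌊l⌋₊ with hm
    have hm5 : 5 ≤ m := Nat.le_floor (by exact_mod_cast hl5)
    have hml : (m : ℝ) ≤ l := Nat.floor_le (by linarith)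
    have hIm : (I.card : ℝ) ≤ 2 ^ (m + 1) * ε := by
      rw [hI, ← div_le_iff₀ hε0, ← Real.rpow_natCast, ← Real.logb_le_iff_le_rpow one_lt_two hnε]
      push_cast
      exact (Nat.lt_floor_add_one l).le
    have hI0 : 0 < I.card := by omega
    obtain ⟨C', K, J, hJ, hK, hfrob⟩ := C.exists_lightCones ha hI0 hm5 hε0 hIm
    have hK0 : K.Nonempty := by
      rw [Finset.nonempty_iff_ne_empty]
      rintro rfl
      simp only [Finset.card_empty, mul_zero] at hK
      omega
    refine ⟨Kᶜ, C'.acceptProb a q, ?_, C'.acceptProb_mem_Icc ha q, ?_,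
      C'.exists_restrict_acceptProb_eq hJ hK0 ha q⟩
    · rw [compl_compl, div_le_iff₀ (by positivity)]
      calc (n : ℝ) ≤ m ^ d * K.card := by
            rw [← hI]
            exact_mod_cast hK
        _ ≤ l ^ d * K.card := by gcongr
        _ = _ := mul_comm _ _
    · refine (C.cubeNorm_acceptProb_sub_le C' ha q).trans ?_
      rw [div_le_iff₀ (by positivity)]
      have hle : 8 * ε * (I.card - K.card) / I.card ≤ 8 * ε := by
        have : (0 : ℝ) < I.card := by exact_mod_cast hI0
        rw [div_le_iff₀ this]
        nlinarith [Nat.cast_nonneg (α := ℝ) K.card]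
      calc _ ≤ 2 * (√(2 ^ I.card) * (√d * √(8 * ε))) := by
            refine mul_le_mul_of_nonneg_left (hfrob.trans ?_) zero_le_two
            gcongr
        _ = √(32 * d * ε) * √(2 ^ I.card) := by
            rw [show (32 : ℝ) * d * ε = 2 ^ 2 * (d * (8 * ε)) by ring,
              Real.sqrt_mul (sq_nonneg 2), Real.sqrt_sq (by norm_num),
              Real.sqrt_mul (Nat.cast_nonneg d)]
            ring
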